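/- Let $V$ be a finite set of points in a Euclidean space, with distance $d(i,j)=\|i-j\|_2$, and for a non-empty finite set $S$ let $\rho(S)=\frac1{|S|}\sum_{u\in S}u$. A hierarchical clustering tree on a non-empty $V$ is a binary tree with root $V$, in which every node $S$ with $|S|\ge 2$ is split into two disjoint non-empty sets $S_1,S_2$ with $S=S_1\cup S_2$, and whose leaves are the single points of $V$. A split $S\to(S_1,S_2)$ earns $$rev(S_1,S_2)=\sum_{i\in S_1}\sum_{j\in S_2}\min\Big\{\frac{d(i,j)}{\max\{d(i,\rho(S_1)),\,d(j,\rho(S_2))\}},\,1\Big\},$$ where a term whose denominator is $0$ counts as $1$. The Hierarchical-Revenue of a tree $T$ is $rev_T(V)=\sum_{S\to(S_1,S_2)\in T}rev(S_1,S_2)$, and $OPT(V)=\max_T rev_T(V)$ over all hierarchical clustering trees $T$ on $V$. The Random algorithm produces a random tree: it splits each node $S$ with $|S|\ge2$ by flipping an independent fair coin for each point of $S$, putting the points with heads into $S_1$ and the others into $S_2$ (flipping again if one side is empty), and then treats $S_1$ and $S_2$ independently in the same way. Let $\mathbb{E}_T[rev_T(V)]$ denote the expected Hierarchical-Revenue of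 the tree $T$ produced by Random. **Theorem.** There are constants $\epsilon\in(0,1)$ and $C>0$ such that for every integer $n\ge1$ there is a set $V$ of $n^2+n$ distinct points in some Euclidean space $\mathbb{R}^m$ with $$\mathbb{E}_T[rev_T(V)]\le \frac{C}{n^{\epsilon}}\cdot OPT(V).$$ -/

import Mathlib

open Finset

/-- A hierarchical clustering tree on a finite set `S`: a binary tree whose leaves are the points
of `S`; each internal node splits its set `S` into two disjoint parts `S₁`, `S₂` with union `S`.
There is no tree on the empty set, so both parts of every split are non-empty. -/
inductive HCTree {α : Type*} : Finset α → Type _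
  | leaf {S : Finset α} (i : α) (h : S = {i}) : HCTree S
  | node {S S₁ S₂ : Finset α} (hd : Disjoint S₁ S₂) (hS : S = S₁.disjUnion S₂ hd)
      (l : HCTree S₁) (r : HCTree S₂) : HCTree S

section Revenue

variable {E : Type*} [NormedAddCommGroup E] [NormedSpace ℝ E]

/-- The centroid `ρ(S) = (∑ u ∈ S, u) / |S|` of a finite point set. -/
noncomputable def rho (S : Finset E) : E := (#S : ℝ)⁻¹ • ∑ u ∈ S, u

/-- `δ_{S₁,S₂}(i,j) = max {d(i, ρ(S₁)), d(j, ρ(S₂))}`. -/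
noncomputable def splitDelta (S₁ S₂ : Finset E) (i j : E) : ℝ :=
  max (dist i (rho S₁)) (dist j (rho S₂))

/-- The revenue `min {d(i,j) / δ_{S₁,S₂}(i,j), 1}` of a pair `i ∈ S₁`, `j ∈ S₂`;
division by zero gives revenue `1`. -/
noncomputable def pairRevenue (S₁ S₂ : Finset E) (i j : E) : ℝ :=
  if splitDelta S₁ S₂ i j = 0 then 1 else min (dist i j / splitDelta S₁ S₂ i j) 1

/-- The revenue of the split `S₁ ∪ S₂ → (S₁, S₂)`. -/
noncomputable def splitRevenue (S₁ S₂ : Finset E) : ℝ :=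
  ∑ i ∈ S₁, ∑ j ∈ S₂, pairRevenue S₁ S₂ i j

/-- The Hierarchical-Revenue `rev_T(V)`: the sum of the split revenues over all splits of `T`. -/
noncomputable def treeRevenue : {V : Finset E} → HCTree V → ℝ
  | _, .leaf _ _ => 0
  | _, .node (S₁ := S₁) (S₂ := S₂) _ _ l r => splitRevenue S₁ S₂ + treeRevenue l + treeRevenue r

/-- The optimal Hierarchical-Revenue over all hierarchical clustering trees on `V`. -/
noncomputable def OPT (V : Finset E) : ℝ := ⨆ T : HCTree V, treeRevenue T

theorem pairRevenue_nonneg (S₁ S₂ : Finset E) (i j : E) : 0 ≤ pairRevenue S₁ S₂ i j := by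
  unfold pairRevenue
  split_ifs
  · exact zero_le_one
  · exact le_min (div_nonneg dist_nonneg (le_max_of_le_left dist_nonneg)) zero_le_one

theorem pairRevenue_le_one (S₁ S₂ : Finset E) (i j : E) : pairRevenue S₁ S₂ i j ≤ 1 := by
  unfold pairRevenue
  split_ifs
  · exact le_rfl
  · exact min_le_right _ _

theorem treeRevenue_nonneg {V : Finset E} (T : HCTree V) : 0 ≤ treeRevenue T := by
  induction T with
  | leaf i h => simp [treeRevenue]
  | @node S S₁ S₂ hd hS l r hl hr =>
    have h : 0 ≤ splitRevenue S₁ S₂ :=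
      Finset.sum_nonneg fun i _ => Finset.sum_nonneg fun j _ => pairRevenue_nonneg _ _ i j
    simp only [treeRevenue]
    exact add_nonneg (add_nonneg h hl) hr

/-- Revenues of trees on `V` are bounded, so the supremum in `OPT` and the expectation
in `expectedRevenue` are genuine. -/
theorem treeRevenue_le {V : Finset E} (T : HCTree V) : treeRevenue T ≤ (#V : ℝ) ^ 2 := by
  induction T with
  | leaf i h => simp only [treeRevenue]; positivity
  | @node S S₁ S₂ hd hS l r hl hr =>
    have h : splitRevenue S₁ S₂ ≤ (#S₁ : ℝ) * #S₂ := by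
      calc splitRevenue S₁ S₂ ≤ ∑ i ∈ S₁, ∑ j ∈ S₂, (1 : ℝ) :=
            Finset.sum_le_sum fun i _ => Finset.sum_le_sum fun j _ => pairRevenue_le_one _ _ i j
        _ = (#S₁ : ℝ) * #S₂ := by simp
    have hc : (#S : ℝ) = #S₁ + #S₂ := by rw [hS, Finset.card_disjUnion]; push_cast; rfl
    have h0 : (0 : ℝ) ≤ (#S₁ : ℝ) * #S₂ := by positivity
    simp only [treeRevenue]
    rw [hc]
    nlinarith

end Revenue

section Random

variable {α : Type*}

/-- The points of `S` whose coin shows `b`. -/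
def coinSide {S : Finset α} (c : S → Bool) (b : Bool) : Finset α :=
  (Finset.univ.filter fun i : S => c i = b).map (Function.Embedding.subtype _)

theorem mem_coinSide {S : Finset α} (c : S → Bool) (b : Bool) (x : α) :
    x ∈ coinSide c b ↔ ∃ h : x ∈ S, c ⟨x, h⟩ = b := by
  simp [coinSide]

theorem coinSide_disjoint {S : Finset α} (c : S → Bool) :
    Disjoint (coinSide c true) (coinSide c false) := by
  rw [Finset.disjoint_left]
  intro x h1 h2
  obtain ⟨h, e⟩ := (mem_coinSide _ _ _).1 h1
  obtain ⟨_, e'⟩ := (mem_coinSide _ _ _).1 h2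
  simp [e] at e'

theorem coinSide_union {S : Finset α} (c : S → Bool) :
    S = (coinSide c true).disjUnion (coinSide c false) (coinSide_disjoint c) := by
  ext x
  simp only [Finset.mem_disjUnion, mem_coinSide]
  constructor
  · intro h
    cases e : c ⟨x, h⟩
    · exact Or.inr ⟨h, e⟩
    · exact Or.inl ⟨h, e⟩
  · rintro (⟨h, _⟩ | ⟨h, _⟩) <;> exact h

/-- The coin outcomes for which both sides are non-empty, i.e. which split `S`. -/
def properFlips (S : Finset α) : Set (S → Bool) :=
  {c | (coinSide c true).Nonempty ∧ (coinSide c false).Nonempty}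

open Classical in
/-- One independent fair coin for each point of `S`: the uniform distribution on `{0,1}^S`. -/
noncomputable def fairCoins (S : Finset α) : PMF (S → Bool) :=
  PMF.uniformOfFintype (S → Bool)

theorem exists_properFlip {S : Finset α} (hS : S.Nontrivial) :
    ∃ c ∈ properFlips S, c ∈ (fairCoins S).support := by
  classical
  obtain ⟨x, hx, y, hy, hxy⟩ := hS
  refine ⟨fun i => decide (i.1 = x), ⟨⟨x, ?_⟩, ⟨y, ?_⟩⟩, ?_⟩
  · exact (mem_coinSide _ _ _).2 ⟨hx, by simp⟩
  · exact (mem_coinSide _ _ _).2 ⟨hy, by simpa using hxy.symm⟩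
  · rw [fairCoins, PMF.support_uniformOfFintype]
    trivial

/-- The law of the split of a set with at least two points: independent fair coins,
conditioned on both sides being non-empty (flips that split nothing are repeated). -/
noncomputable def randomFlip (S : Finset α) (hS : S.Nontrivial) : PMF (S → Bool) :=
  (fairCoins S).filter (properFlips S) (exists_properFlip hS)

theorem randomFlip_proper {S : Finset α} {hS : S.Nontrivial} {c : S → Bool}
    (hc : c ∈ (randomFlip S hS).support) : c ∈ properFlips S :=
  ((PMF.mem_support_filter_iff _).1 hc).1

theorem coinSide_card_lt {S : Finset α} {c : S → Bool} (hc : c ∈ properFlips S) (b : Bool) :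
    #(coinSide c b) < #S := by
  have h : #S = #(coinSide c true) + #(coinSide c false) := by
    conv_lhs => rw [coinSide_union c]
    rw [Finset.card_disjUnion]
  have h1 := hc.1.card_pos
  have h2 := hc.2.card_pos
  cases b <;> omega

/-- The law of the tree produced by the Random algorithm on a non-empty finite set `S`:
a single point is a leaf, and a larger set is split by `randomFlip`, after which the two
parts are processed independently in the same way. -/
noncomputable def randomTree (S : Finset α) (hS : S.Nonempty) : PMF (HCTree S) :=
  if h : S.Nontrivial then
    (randomFlip S h).bindOnSupport fun c hc =>
      (randomTree (coinSide c true) (randomFlip_proper hc).1).bind fun l =>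
        (randomTree (coinSide c false) (randomFlip_proper hc).2).bind fun r =>
          PMF.pure (HCTree.node (coinSide_disjoint c) (coinSide_union c) l r)
  else
    PMF.pure (HCTree.leaf hS.choose
      (Finset.eq_singleton_iff_unique_mem.2 ⟨hS.choose_spec, fun y hy => by
        by_contra hne
        exact h ⟨y, hy, hS.choose, hS.choose_spec, hne⟩⟩))
termination_by #S
decreasing_by
  · exact coinSide_card_lt (randomFlip_proper hc) true
  · exact coinSide_card_lt (randomFlip_proper hc) false

end Random

/-- The expected Hierarchical-Revenue `𝔼_T[rev_T(V)]` of the tree `T` produced by Random. -/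
noncomputable def expectedRevenue {E : Type*} [NormedAddCommGroup E] [NormedSpace ℝ E]
    (V : Finset E) (hV : V.Nonempty) : ℝ :=
  ∑' T : HCTree V, (randomTree V hV T).toReal * treeRevenue T

/-! Take a cluster `A` of `n ^ 2` points and a cluster `B` of `n` points, each equidistant with tiny
distance `r`, at distance at least `1` from one another. Cutting `A` from `B` first lets every pair
of `A`, and every pair between `A` and `B`, earn `1`, so `OPT` is at least `n ^ 4 / 2`.

Random seldom isolates `A` early. If a pair of `A` is separated at a node still holding a point of
`B`, one of the two centroids is at least `1 / #V` away from `A`, so the pair earns at most `#V * r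
= 1 / n` (`pairRevenue_le_of_far`). Pairs separated at nodes inside `A` are controlled by `C(a, 2) /
(b + 1)`, where `a` and `b` count the points of the node in and outside `A`: summed over the two
children, its mean does not increase (`sum_properFlips_purePairBound_le`). At the root it is at most
of order `n ^ 3`, as are the number of pairs meeting `B` and `1 / n` times the number of pairs of
`A`. `revenuePotential` adds the three contributions, and `expect_treeRevenue_le` turns it into a
bound on the expectation. -/

/-! ### Expectations under the law of Random, and the potential method -/

section Expectation

open scoped ENNReal

/-- The expectation of an extended non-negative function under a probability mass function. -/
noncomputable def PMF.expect {β : Type*} (p : PMF β) (f : β → ℝ≥0∞) : ℝ≥0∞ := ∑' x, p x * f x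

namespace PMF

variable {β γ : Type*}

theorem expect_pure (a : β) (f : β → ℝ≥0∞) : (pure a).expect f = f a := by
  rw [expect, tsum_eq_single a fun b hb => by rw [pure_apply_of_ne _ _ hb, zero_mul]]
  rw [pure_apply_self, one_mul]

theorem expect_bindOnSupport (p : PMF β) (q : ∀ a ∈ p.support, PMF γ) (f : γ → ℝ≥0∞) :
    (p.bindOnSupport q).expect f =
      p.expect fun a => if h : p a = 0 then 0 else (q a h).expect f := by
  simp only [expect, bindOnSupport_apply, ← ENNReal.tsum_mul_right]
  rw [ENNReal.tsum_comm]
  refine tsum_congr fun a => ?_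
  by_cases h : p a = 0
  · simp [h]
  · simp only [h, dite_false, ← ENNReal.tsum_mul_left, mul_assoc]

theorem expect_bind (p : PMF β) (q : β → PMF γ) (f : γ → ℝ≥0∞) :
    (p.bind q).expect f = p.expect fun a => (q a).expect f := by
  simp only [expect, bind_apply, ← ENNReal.tsum_mul_right]
  rw [ENNReal.tsum_comm]
  simp only [← ENNReal.tsum_mul_left, mul_assoc]

theorem expect_const (p : PMF β) (r : ℝ≥0∞) : (p.expect fun _ => r) = r := by
  rw [expect, ENNReal.tsum_mul_right, p.tsum_coe, one_mul]

theorem expect_add (p : PMF β) (f g : β → ℝ≥0∞) :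
    (p.expect fun a => f a + g a) = p.expect f + p.expect g := by
  simp only [expect, mul_add, ENNReal.tsum_add]

end PMF

-- The law is uniform on the proper flips, so its normalizing constant cancels and a bound on the
-- mean becomes a comparison of unweighted finite sums.
open Classical in
theorem expect_randomFlip_le {α : Type*} {S : Finset α} (hS : S.Nontrivial)
    (f : (S → Bool) → ℝ≥0∞) (r : ℝ≥0∞)
    (h : ∑ c with c ∈ properFlips S, f c ≤ ∑ c : S → Bool with c ∈ properFlips S, r) :
    (randomFlip S hS).expect f ≤ r := by
  have hset : ∀ g : (S → Bool) → ℝ≥0∞,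
      ∑ c, (properFlips S).indicator (fairCoins S) c * g c =
        (Fintype.card (S → Bool) : ℝ≥0∞)⁻¹ * ∑ c with c ∈ properFlips S, g c := by
    intro g
    rw [sum_filter, mul_sum]
    refine sum_congr rfl fun c _ => ?_
    by_cases hc : c ∈ properFlips S
    · simp [hc, fairCoins, PMF.uniformOfFintype_apply]
    · simp [hc]
  have hle : ∑ c, (properFlips S).indicator (fairCoins S) c * f c ≤
      (∑ c, (properFlips S).indicator (fairCoins S) c) * r := by
    rw [sum_mul, hset, hset]
    gcongr
  obtain ⟨c, hc, hc'⟩ := exists_properFlip hS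
  have hne : ∑ c, (properFlips S).indicator (fairCoins S) c ≠ 0 := by
    intro h0
    have := (sum_eq_zero_iff.1 h0) c (mem_univ _)
    rw [Set.indicator_of_mem hc] at this
    exact hc' this
  have htop : ∑ c, (properFlips S).indicator (fairCoins S) c ≠ ⊤ := by
    refine ENNReal.sum_ne_top.2 fun c _ => ne_top_of_le_ne_top (PMF.apply_ne_top (fairCoins S) c) ?_
    exact Set.indicator_le_self _ _ c
  simp only [PMF.expect, randomFlip, PMF.filter_apply, tsum_fintype]
  simp only [mul_right_comm _ (∑ c, (properFlips S).indicator (fairCoins S) c)⁻¹]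
  rw [← sum_mul, ← div_eq_mul_inv]
  exact ENNReal.div_le_of_le_mul' hle

section

variable {E : Type*} [NormedAddCommGroup E] [NormedSpace ℝ E]

theorem splitRevenue_nonneg (S₁ S₂ : Finset E) : 0 ≤ splitRevenue S₁ S₂ :=
  Finset.sum_nonneg fun i _ => Finset.sum_nonneg fun j _ => pairRevenue_nonneg _ _ i j

open Classical in
/-- A potential `Ψ` that pays on average for each random split bounds the expected revenue. -/
theorem expect_treeRevenue_le (V : Finset E) (Ψ : Finset E → ℝ) (h0 : ∀ S, 0 ≤ Ψ S)
    (hΨ : ∀ S ⊆ V, ∑ c with c ∈ properFlips S,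
        (splitRevenue (coinSide c true) (coinSide c false) +
          Ψ (coinSide c true) + Ψ (coinSide c false)) ≤
      ∑ c : S → Bool with c ∈ properFlips S, Ψ S)
    (S : Finset E) (hSV : S ⊆ V) (hS : S.Nonempty) :
    (randomTree S hS).expect (fun T => ENNReal.ofReal (treeRevenue T)) ≤
      ENNReal.ofReal (Ψ S) := by
  induction hk : #S using Nat.strong_induction_on generalizing S with
  | _ k ih =>
  subst hk
  unfold randomTree
  split_ifs with h
  · rw [PMF.expect_bindOnSupport]
    have hsub : ∀ (c : S → Bool) b, coinSide c b ⊆ V := fun c b x hx =>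
      hSV ((mem_coinSide _ _ _).1 hx).1
    have hbound : ∑ c with c ∈ properFlips S,
        ENNReal.ofReal (splitRevenue (coinSide c true) (coinSide c false) +
          Ψ (coinSide c true) + Ψ (coinSide c false)) ≤
        ∑ c : S → Bool with c ∈ properFlips S, ENNReal.ofReal (Ψ S) := by
      rw [← ENNReal.ofReal_sum_of_nonneg, ← ENNReal.ofReal_sum_of_nonneg]
      · exact ENNReal.ofReal_le_ofReal (hΨ S hSV)
      · exact fun _ _ => h0 _
      · exact fun _ _ => add_nonneg (add_nonneg (splitRevenue_nonneg _ _) (h0 _)) (h0 _)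
    refine le_trans ?_ (expect_randomFlip_le h _ _ hbound)
    refine ENNReal.tsum_le_tsum fun c => ?_
    by_cases hc : randomFlip S h c = 0
    · simp [hc]
    refine mul_le_mul_right ?_ _
    beta_reduce
    split_ifs
    have hp := randomFlip_proper hc
    rw [PMF.expect_bind]
    simp only [PMF.expect_bind, PMF.expect_pure, treeRevenue]
    have e : ∀ (l : HCTree (coinSide c true)) (r : HCTree (coinSide c false)),
        ENNReal.ofReal (splitRevenue (coinSide c true) (coinSide c false) + treeRevenue l +
          treeRevenue r) =
        ENNReal.ofReal (splitRevenue (coinSide c true) (coinSide c false)) +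
          ENNReal.ofReal (treeRevenue l) + ENNReal.ofReal (treeRevenue r) := fun l r => by
      rw [ENNReal.ofReal_add (add_nonneg (splitRevenue_nonneg _ _) (treeRevenue_nonneg _))
        (treeRevenue_nonneg _), ENNReal.ofReal_add (splitRevenue_nonneg _ _)
        (treeRevenue_nonneg _)]
    -- By linearity only the marginal laws of the two subtrees matter.
    simp only [e, PMF.expect_add, PMF.expect_const]
    rw [ENNReal.ofReal_add (add_nonneg (splitRevenue_nonneg _ _) (h0 _)) (h0 _),
      ENNReal.ofReal_add (splitRevenue_nonneg _ _) (h0 _)]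
    gcongr
    · exact ih _ (coinSide_card_lt hp true) _ (hsub c true) _ rfl
    · exact ih _ (coinSide_card_lt hp false) _ (hsub c false) _ rfl
  · rw [PMF.expect_pure]
    simp [treeRevenue]

theorem expectedRevenue_eq_toReal (V : Finset E) (hV : V.Nonempty) :
    expectedRevenue V hV =
      ((randomTree V hV).expect fun T => ENNReal.ofReal (treeRevenue T)).toReal := by
  rw [PMF.expect, ENNReal.tsum_toReal_eq fun T =>
    ENNReal.mul_ne_top (PMF.apply_ne_top _ _) ENNReal.ofReal_ne_top]
  simp only [ENNReal.toReal_mul, ENNReal.toReal_ofReal (treeRevenue_nonneg _)]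
  rfl

theorem expectedRevenue_le_of_expect_le {V : Finset E} {hV : V.Nonempty} {r : ℝ} (hr : 0 ≤ r)
    (h : ((randomTree V hV).expect fun T => ENNReal.ofReal (treeRevenue T)) ≤ ENNReal.ofReal r) :
    expectedRevenue V hV ≤ r := by
  rw [expectedRevenue_eq_toReal]
  exact ENNReal.toReal_le_of_le_ofReal hr h

end

end Expectation

/-! ### Averages over uniformly random subsets -/

section Counting

variable {α : Type*}

/-- A given pair lies in a quarter of all subsets. -/
theorem sum_powerset_choose_two [DecidableEq α] (S : Finset α) :
    ∑ U ∈ S.powerset, ((#U).choose 2 : ℝ) * 4 = (#S).choose 2 * 2 ^ #S := by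
  have h1 : ∀ S : Finset α, ∑ U ∈ S.powerset, (#U : ℝ) * 2 = #S * 2 ^ #S := by
    intro S
    induction S using Finset.induction_on with
    | empty => simp
    | insert x S hx ih =>
      have e : ∀ U ∈ S.powerset, (#(insert x U) : ℝ) * 2 = #U * 2 + 2 := fun U hU => by
        rw [card_insert_of_notMem fun h => hx (mem_powerset.1 hU h)]; push_cast; ring
      rw [sum_powerset_insert hx, sum_congr rfl e, sum_add_distrib, ih, card_insert_of_notMem hx]
      simp only [sum_const, card_powerset, nsmul_eq_mul]
      push_cast; ring
  induction S using Finset.induction_on with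
  | empty => simp
  | insert x S hx ih =>
    have e : ∀ U ∈ S.powerset,
        ((#(insert x U)).choose 2 : ℝ) * 4 = (#U).choose 2 * 4 + 2 * (#U * 2) := fun U hU => by
      rw [card_insert_of_notMem fun h => hx (mem_powerset.1 hU h), Nat.cast_choose_two,
        Nat.cast_choose_two]; push_cast; ring
    rw [sum_powerset_insert hx, sum_congr rfl e, sum_add_distrib, ih, ← mul_sum, h1,
      card_insert_of_notMem hx, Nat.cast_choose_two, Nat.cast_choose_two]
    push_cast; ring

/-- Since `C(b, k) / (k + 1) = C(b + 1, k + 1) / (b + 1)`, the sum equals `(2 ^ (b + 1) - 1) / (b +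
1)`. -/
theorem sum_powerset_inv_card_succ_le (S : Finset α) :
    ∑ U ∈ S.powerset, ((#U : ℝ) + 1)⁻¹ ≤ 2 ^ (#S + 1) / (#S + 1) := by
  rw [sum_powerset_apply_card (fun k => ((k : ℝ) + 1)⁻¹), le_div_iff₀ (by positivity), sum_mul]
  have e : ∀ k ∈ range (#S + 1), (#S).choose k • ((k : ℝ) + 1)⁻¹ * (#S + 1)
      = ((#S + 1).choose (k + 1) : ℝ) := fun k _ => by
    have h : ((#S : ℝ) + 1) * (#S).choose k = (#S + 1).choose (k + 1) * (k + 1) := by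
      exact_mod_cast Nat.add_one_mul_choose_eq (#S) k
    have hk : (k : ℝ) + 1 ≠ 0 := by positivity
    rw [nsmul_eq_mul]
    field_simp
    linarith
  rw [sum_congr rfl e]
  have h := Nat.sum_range_choose (#S + 1)
  rw [sum_range_succ'] at h
  have : (∑ k ∈ range (#S + 1), ((#S + 1).choose (k + 1) : ℝ)) + 1 = 2 ^ (#S + 1) := by
    exact_mod_cast h
  linarith

/-- Independence of the coins on the two classes of points: a subset is a free choice in each class.
-/
theorem sum_powerset_filter_mul [DecidableEq α] (p : α → Prop) [DecidablePred p] (f g : Finset α → ℝ)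
    (S : Finset α) :
    ∑ U ∈ S.powerset, f (U.filter p) * g (U.filter fun x => ¬ p x) =
      (∑ X ∈ (S.filter p).powerset, f X) * ∑ Y ∈ (S.filter fun x => ¬ p x).powerset, g Y := by
  rw [sum_mul_sum, ← sum_product']
  refine sum_bij' (fun U _ => (U.filter p, U.filter fun x => ¬ p x)) (fun q _ => q.1 ∪ q.2)
    ?_ ?_ ?_ ?_ ?_
  · intro U hU
    rw [mem_powerset] at hU
    exact mem_product.2 ⟨mem_powerset.2 (filter_subset_filter _ hU),
      mem_powerset.2 (filter_subset_filter _ hU)⟩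
  · rintro ⟨X, Y⟩ h
    rw [mem_product, mem_powerset, mem_powerset] at h
    exact mem_powerset.2 (union_subset (h.1.trans (filter_subset _ _))
      (h.2.trans (filter_subset _ _)))
  · intro U _
    exact filter_union_filter_not_eq p U
  · rintro ⟨X, Y⟩ h
    rw [mem_product, mem_powerset, mem_powerset] at h
    have h1 : ∀ x ∈ X, p x := fun x hx => (mem_filter.1 (h.1 hx)).2
    have h2 : ∀ x ∈ Y, ¬ p x := fun x hx => (mem_filter.1 (h.2 hx)).2
    ext x <;> simp only [mem_filter, mem_union] <;> grind
  · intro U _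
    rfl

/-- The number of pairs of points of `S` in `A`, divided by one more than the number of points of
`S` outside `A`. It bounds the expected number of pairs of `A` that the Random algorithm, started
at `S`, separates at nodes contained in `A`. -/
noncomputable def purePairBound [DecidableEq α] (A S : Finset α) : ℝ :=
  (#(S.filter (· ∈ A))).choose 2 * ((#(S.filter (· ∉ A)) : ℝ) + 1)⁻¹

theorem purePairBound_nonneg [DecidableEq α] (A S : Finset α) : 0 ≤ purePairBound A S := by
  unfold purePairBound; positivity

theorem purePairBound_empty [DecidableEq α] (A : Finset α) : purePairBound A ∅ = 0 := by
  simp [purePairBound]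

/-- On average `C(a, 2)` shrinks by a factor `4` and `1 / (b + 1)` grows by at most `2`. The two
children make up for the remaining factor `2`. -/
theorem sum_powerset_purePairBound_le [DecidableEq α] (A S : Finset α) :
    2 * ∑ U ∈ S.powerset, purePairBound A U ≤ 2 ^ #S * purePairBound A S := by
  have e := sum_powerset_filter_mul (· ∈ A) (fun X => ((#X).choose 2 : ℝ))
    (fun Y => ((#Y : ℝ) + 1)⁻¹) S
  have h1 := sum_powerset_choose_two (S.filter (· ∈ A))
  have h2 := sum_powerset_inv_card_succ_le (S.filter (· ∉ A))
  have hc : #S = #(S.filter (· ∈ A)) + #(S.filter (· ∉ A)) :=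
    (card_filter_add_card_filter_not _).symm
  rw [← sum_mul] at h1
  unfold purePairBound
  rw [e, hc]
  generalize #(S.filter (· ∈ A)) = a at *
  generalize #(S.filter (· ∉ A)) = b at *
  have h1' : ∑ X ∈ (S.filter (· ∈ A)).powerset, ((#X).choose 2 : ℝ) = a.choose 2 * 2 ^ a / 4 := by
    linarith
  rw [h1']
  calc 2 * ((a.choose 2 * 2 ^ a / 4 : ℝ) * _)
      ≤ 2 * ((a.choose 2 * 2 ^ a / 4 : ℝ) * (2 ^ (b + 1) / (b + 1))) := by gcongr
    _ = _ := by rw [pow_add, pow_add, pow_one]; field_simp; ring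

theorem coinSide_not (S : Finset α) (c : S → Bool) :
    coinSide (fun i => !c i) true = coinSide c false := by
  ext x; simp [mem_coinSide]

theorem sum_coinSide_true [DecidableEq α] (S : Finset α) (f : Finset α → ℝ) :
    ∑ c : S → Bool, f (coinSide c true) = ∑ U ∈ S.powerset, f U := by
  refine sum_bij' (fun c _ => coinSide c true) (fun U _ i => decide (i.1 ∈ U)) ?_ ?_ ?_ ?_ ?_
  · intro c _
    exact mem_powerset.2 fun x hx => ((mem_coinSide _ _ _).1 hx).1
  · intros; exact mem_univ _
  · intro c _
    funext i
    simp [mem_coinSide]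
  · intro U hU
    ext x
    simp only [mem_coinSide, decide_eq_true_eq]
    exact ⟨fun h => h.2, fun h => ⟨mem_powerset.1 hU h, h⟩⟩
  · intros; rfl

theorem sum_coinSide_false [DecidableEq α] (S : Finset α) (f : Finset α → ℝ) :
    ∑ c : S → Bool, f (coinSide c false) = ∑ U ∈ S.powerset, f U := by
  rw [← sum_coinSide_true]
  refine Fintype.sum_equiv (Equiv.arrowCongr (Equiv.refl _) Equiv.boolNot) _ _ fun c => ?_
  rw [← coinSide_not]
  rfl

open Classical in
/-- The fair-coin split does not increase `purePairBound` on average. -/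
theorem sum_properFlips_purePairBound_le [DecidableEq α] (A S : Finset α) :
    ∑ c with c ∈ properFlips S,
        (purePairBound A (coinSide c true) + purePairBound A (coinSide c false)) ≤
      ∑ c : S → Bool with c ∈ properFlips S, purePairBound A S := by
  have hall : ∑ c : S → Bool,
      (purePairBound A (coinSide c true) + purePairBound A (coinSide c false)) ≤
      ∑ c : S → Bool, purePairBound A S := by
    rw [sum_add_distrib, sum_coinSide_true, sum_coinSide_false, ← two_mul, sum_const, card_univ,
      nsmul_eq_mul]
    simpa using sum_powerset_purePairBound_le A S
  -- An improper flip returns `S` and `∅`, so it contributes equally to both sides and conditioning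
  -- on proper flips preserves the inequality.
  have himp : ∑ c : S → Bool with ¬ c ∈ properFlips S,
      (purePairBound A (coinSide c true) + purePairBound A (coinSide c false)) =
      ∑ c : S → Bool with ¬ c ∈ properFlips S, purePairBound A S := by
    refine sum_congr rfl fun c hc => ?_
    have hc := (mem_filter.1 hc).2
    have hu := coinSide_union c
    rw [disjUnion_eq_union] at hu
    simp only [properFlips, Set.mem_ofPred_eq, not_and_or, not_nonempty_iff_eq_empty] at hc
    rcases hc with h | h
    · rw [h, empty_union] at hu
      rw [h, ← hu, purePairBound_empty, zero_add]
    · rw [h, union_empty] at hu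
      rw [h, ← hu, purePairBound_empty, add_zero]
  rw [← sum_filter_add_sum_filter_not univ (· ∈ properFlips S),
    ← sum_filter_add_sum_filter_not univ (· ∈ properFlips S) fun _ => purePairBound A S] at hall
  linarith

end Counting

/-! ### Revenue of splits near and far from the cluster -/

section Geometry

/-- Bounds the expected revenue of Random started at `S`: pairs meeting the complement of `A` are
counted in full, pairs of `A` separated away from `A` at rate `τ`, and pairs of `A` separated
inside `A` by `purePairBound`. -/
noncomputable def revenuePotential {α : Type*} [DecidableEq α] (A : Finset α) (τ : ℝ) (S : Finset α) : ℝ :=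
  (#S).choose 2 - (1 - τ) * (#(S.filter (· ∈ A))).choose 2 + purePairBound A S

theorem revenuePotential_nonneg {α : Type*} [DecidableEq α] {τ : ℝ} (h0 : 0 ≤ τ) (A S : Finset α) : 0 ≤ revenuePotential A τ S := by
  have h1 : ((#(S.filter (· ∈ A))).choose 2 : ℝ) ≤ (#S).choose 2 := by
    exact_mod_cast Nat.choose_le_choose 2 (card_filter_le _ _)
  have h2 := purePairBound_nonneg A S
  have h3 : 0 ≤ τ * ((#(S.filter (· ∈ A))).choose 2 : ℝ) := by positivity
  unfold revenuePotential
  linarith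

variable {E : Type*} [NormedAddCommGroup E] [NormedSpace ℝ E]

/-- Balls are convex, so they contain the centroid of any points they contain. -/
theorem dist_rho_le {S : Finset E} (hS : S.Nonempty) {i : E} {r : ℝ}
    (h : ∀ u ∈ S, dist i u ≤ r) : dist i (rho S) ≤ r := by
  have hm : rho S ∈ Metric.closedBall i r := by
    have := (convex_closedBall i r).centerMass_mem (t := S) (w := fun _ => (1 : ℝ)) (z := id)
      (fun _ _ => zero_le_one) (by simpa using hS)
      (fun u hu => by simpa [dist_comm] using h u hu)
    simpa [centerMass, rho] using this
  simpa [dist_comm] using hm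

theorem splitRevenue_eq_card_mul {S₁ S₂ : Finset E} {r : ℝ}
    (h₁ : ∀ i ∈ S₁, ∀ k ∈ S₁, dist i k ≤ r) (h₂ : ∀ i ∈ S₂, ∀ k ∈ S₂, dist i k ≤ r)
    (h₁₂ : ∀ i ∈ S₁, ∀ j ∈ S₂, r ≤ dist i j) : splitRevenue S₁ S₂ = #S₁ * #S₂ := by
  have e : ∀ i ∈ S₁, ∀ j ∈ S₂, pairRevenue S₁ S₂ i j = 1 := by
    intro i hi j hj
    unfold pairRevenue
    split_ifs with h0
    · rfl
    · have hle : splitDelta S₁ S₂ i j ≤ dist i j :=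
        (max_le (dist_rho_le ⟨i, hi⟩ (h₁ i hi)) (dist_rho_le ⟨j, hj⟩ (h₂ j hj))).trans (h₁₂ i hi j hj)
      have hpos : 0 < splitDelta S₁ S₂ i j :=
        lt_of_le_of_ne (le_max_of_le_left dist_nonneg) (Ne.symm h0)
      exact min_eq_right ((one_le_div hpos).2 hle)
  unfold splitRevenue
  rw [sum_congr rfl fun i hi => sum_congr rfl (e i hi)]
  simp

/-- On an equidistant set every pair of points earns full revenue in every tree. -/
theorem treeRevenue_of_equidistant {S : Finset E} (T : HCTree S) {r : ℝ} (hr : 0 ≤ r)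
    (h : ∀ i ∈ S, ∀ j ∈ S, i ≠ j → dist i j = r) : treeRevenue T = (#S).choose 2 := by
  induction T with
  | leaf i hi => simp [treeRevenue, hi]
  | @node S S₁ S₂ hd hS l r' hl hr' =>
    have hm : ∀ x, x ∈ S ↔ x ∈ S₁ ∨ x ∈ S₂ := fun x => by rw [hS, mem_disjUnion]
    have hle : ∀ i ∈ S, ∀ j ∈ S, dist i j ≤ r := fun i hi j hj => by
      by_cases hij : i = j
      · simpa [hij] using hr
      · exact (h i hi j hj hij).le
    have h₁ : ∀ x ∈ S₁, x ∈ S := fun x hx => (hm x).2 (Or.inl hx)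
    have h₂ : ∀ x ∈ S₂, x ∈ S := fun x hx => (hm x).2 (Or.inr hx)
    simp only [treeRevenue]
    rw [hl fun i hi j hj => h i (h₁ i hi) j (h₁ j hj),
      hr' fun i hi j hj => h i (h₂ i hi) j (h₂ j hj),
      splitRevenue_eq_card_mul (fun i hi j hj => hle i (h₁ i hi) j (h₁ j hj))
        (fun i hi j hj => hle i (h₂ i hi) j (h₂ j hj))
        (fun i hi j hj => (h i (h₁ i hi) j (h₂ j hj) fun e =>
          Finset.disjoint_left.1 hd hi (e ▸ hj)).ge), hS, card_disjUnion]
    simp only [Nat.cast_choose_two]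
    push_cast; ring

theorem HCTree.nonempty {α : Type*} {S : Finset α} (hS : S.Nonempty) : Nonempty (HCTree S) :=
  ⟨(randomTree S hS).support_nonempty.choose⟩

theorem treeRevenue_le_OPT {V : Finset E} (T : HCTree V) : treeRevenue T ≤ OPT V :=
  le_ciSup (f := fun T : HCTree V => treeRevenue T)
    ⟨(#V : ℝ) ^ 2, by rintro _ ⟨T, rfl⟩; exact treeRevenue_le T⟩ T

/-- The witness cuts `A` from `B` at the root; the subtrees are arbitrary, and the revenue inside
`B` is discarded. -/
theorem le_OPT_of_equidistant {A B V : Finset E} (hd : Disjoint A B) (hV : V = A.disjUnion B hd)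
    (hA : A.Nonempty) (hB : B.Nonempty) {r : ℝ} (hr : 0 ≤ r)
    (hAr : ∀ i ∈ A, ∀ j ∈ A, i ≠ j → dist i j = r)
    (hBr : ∀ i ∈ B, ∀ j ∈ B, i ≠ j → dist i j = r) (hABr : ∀ i ∈ A, ∀ j ∈ B, r ≤ dist i j) :
    ((#A).choose 2 : ℝ) + #A * #B ≤ OPT V := by
  obtain ⟨l⟩ := HCTree.nonempty hA
  obtain ⟨t⟩ := HCTree.nonempty hB
  refine le_trans ?_ (treeRevenue_le_OPT (HCTree.node hd hV l t))
  have hle : ∀ S : Finset E, (∀ i ∈ S, ∀ j ∈ S, i ≠ j → dist i j = r) →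
      ∀ i ∈ S, ∀ j ∈ S, dist i j ≤ r := fun S hS i hi j hj => by
    by_cases hij : i = j
    · simpa [hij] using hr
    · exact (hS i hi j hj hij).le
  simp only [treeRevenue]
  rw [splitRevenue_eq_card_mul (hle A hAr) (hle B hBr) hABr,
    treeRevenue_of_equidistant l hr hAr]
  linarith [treeRevenue_nonneg t]

theorem splitRevenue_le_card_mul (S₁ S₂ : Finset E) : splitRevenue S₁ S₂ ≤ #S₁ * #S₂ := by
  refine (sum_le_sum fun i _ => sum_le_sum fun j _ => pairRevenue_le_one S₁ S₂ i j).trans_eq ?_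
  simp

variable [DecidableEq E] {A V : Finset E} {ℓ : E →ₗ[ℝ] ℝ} {τ : ℝ}

/-- The value of `ℓ` at the centroid is the fraction of points of `S` outside `A`, at least `1 /
#S`, while `ℓ` vanishes on `A` and is 1-Lipschitz. -/
theorem inv_card_le_dist_rho (hℓ : ∀ x, |ℓ x| ≤ ‖x‖) (hA : ∀ x ∈ A, ℓ x = 0)
    (hVA : ∀ x ∈ V, x ∉ A → ℓ x = 1) {S : Finset E} (hSV : S ⊆ V) {i x : E} (hi : i ∈ A)
    (hx : x ∈ S) (hxA : x ∉ A) : (#V : ℝ)⁻¹ ≤ dist i (rho S) := by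
  have hsum : ∑ u ∈ S, ℓ u = #(S.filter (· ∉ A)) := by
    rw [card_filter, Nat.cast_sum]
    refine sum_congr rfl fun u hu => ?_
    split_ifs with h
    · simpa using hA u h
    · simpa using hVA u (hSV hu) h
  have hρ : ℓ (rho S) = (#S : ℝ)⁻¹ * #(S.filter (· ∉ A)) := by
    rw [rho, map_smul, map_sum, hsum, smul_eq_mul]
  have h1 : (1 : ℝ) ≤ #(S.filter (· ∉ A)) := by
    exact_mod_cast card_pos.2 ⟨x, mem_filter.2 ⟨hx, hxA⟩⟩
  have hS0 : (0 : ℝ) < #S := by exact_mod_cast card_pos.2 ⟨x, hx⟩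
  have hSV' : (#S : ℝ) ≤ #V := by exact_mod_cast card_le_card hSV
  have h2 : (#V : ℝ)⁻¹ ≤ ℓ (rho S) := by
    rw [hρ]
    calc (#V : ℝ)⁻¹ ≤ (#S : ℝ)⁻¹ := by gcongr
      _ ≤ _ := le_mul_of_one_le_right (by positivity) h1
  calc (#V : ℝ)⁻¹ ≤ |ℓ (rho S - i)| := by
        rw [map_sub, hA i hi, sub_zero]; exact h2.trans (le_abs_self _)
    _ ≤ ‖rho S - i‖ := hℓ _
    _ = dist i (rho S) := by rw [dist_comm, dist_eq_norm]

theorem pairRevenue_le_of_far (hℓ : ∀ x, |ℓ x| ≤ ‖x‖) (hA : ∀ x ∈ A, ℓ x = 0)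
    (hVA : ∀ x ∈ V, x ∉ A → ℓ x = 1) (hτ : ∀ i ∈ A, ∀ j ∈ A, dist i j * #V ≤ τ)
    {S₁ S₂ : Finset E} (h₁ : S₁ ⊆ V) (h₂ : S₂ ⊆ V) {i j x : E} (hi : i ∈ A) (hj : j ∈ A)
    (hx : x ∈ S₁ ∨ x ∈ S₂) (hxA : x ∉ A) : pairRevenue S₁ S₂ i j ≤ τ := by
  have hδ : (#V : ℝ)⁻¹ ≤ splitDelta S₁ S₂ i j := by
    rcases hx with hx | hx
    · exact le_max_of_le_left (inv_card_le_dist_rho hℓ hA hVA h₁ hi hx hxA)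
    · exact le_max_of_le_right (inv_card_le_dist_rho hℓ hA hVA h₂ hj hx hxA)
  have hV : (0 : ℝ) < #V := by
    exact_mod_cast card_pos.2 ⟨x, hx.elim (fun h => h₁ h) fun h => h₂ h⟩
  have hpos : 0 < splitDelta S₁ S₂ i j := (inv_pos.2 hV).trans_le hδ
  unfold pairRevenue
  rw [if_neg hpos.ne']
  refine (min_le_left _ _).trans (le_trans ?_ (hτ i hi j hj))
  rw [div_le_iff₀ hpos, mul_assoc]
  refine le_mul_of_one_le_right dist_nonneg ?_
  calc (1 : ℝ) = #V * (#V : ℝ)⁻¹ := (mul_inv_cancel₀ hV.ne').symm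
    _ ≤ _ := by gcongr

theorem splitRevenue_le_of_far (hℓ : ∀ x, |ℓ x| ≤ ‖x‖) (hA : ∀ x ∈ A, ℓ x = 0)
    (hVA : ∀ x ∈ V, x ∉ A → ℓ x = 1) (hτ : ∀ i ∈ A, ∀ j ∈ A, dist i j * #V ≤ τ)
    {S₁ S₂ : Finset E} (h₁ : S₁ ⊆ V) (h₂ : S₂ ⊆ V) {x : E}
    (hx : x ∈ S₁ ∨ x ∈ S₂) (hxA : x ∉ A) :
    splitRevenue S₁ S₂ ≤
      #S₁ * #S₂ - (1 - τ) * (#(S₁.filter (· ∈ A)) * #(S₂.filter (· ∈ A))) := by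
  have hpair : ∀ i ∈ S₁, ∀ j ∈ S₂, pairRevenue S₁ S₂ i j ≤
      1 - (1 - τ) * ((if i ∈ A then 1 else 0) * if j ∈ A then 1 else 0) := by
    intro i _ j _
    by_cases hi : i ∈ A
    · by_cases hj : j ∈ A
      · simpa [hi, hj] using pairRevenue_le_of_far hℓ hA hVA hτ h₁ h₂ hi hj hx hxA
      · simpa [hj] using pairRevenue_le_one S₁ S₂ i j
    · simpa [hi] using pairRevenue_le_one S₁ S₂ i j
  refine (sum_le_sum fun i hi => sum_le_sum (hpair i hi)).trans_eq ?_
  simp only [sum_sub_distrib, ← mul_sum, ← sum_mul, sum_const, nsmul_eq_mul, mul_one,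
    card_filter, Nat.cast_sum, Nat.cast_ite, Nat.cast_one, Nat.cast_zero]

/-- Inside `A` the potential is `(1 + τ) * C(#S, 2)`, whose drop pays for any split. Otherwise the
binomial terms drop by exactly the bound of `splitRevenue_le_of_far`, and the change of
`purePairBound` is left to be averaged. -/
theorem splitRevenue_add_revenuePotential_le (hℓ : ∀ x, |ℓ x| ≤ ‖x‖) (hA : ∀ x ∈ A, ℓ x = 0)
    (hVA : ∀ x ∈ V, x ∉ A → ℓ x = 1) (hτ : ∀ i ∈ A, ∀ j ∈ A, dist i j * #V ≤ τ) (h0 : 0 ≤ τ)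
    {S S₁ S₂ : Finset E} (hSV : S ⊆ V) (hd : Disjoint S₁ S₂) (hS : S = S₁.disjUnion S₂ hd) :
    (S ⊆ A → splitRevenue S₁ S₂ + revenuePotential A τ S₁ + revenuePotential A τ S₂ ≤
        revenuePotential A τ S) ∧
      (¬ S ⊆ A → splitRevenue S₁ S₂ + revenuePotential A τ S₁ + revenuePotential A τ S₂ ≤
        revenuePotential A τ S - purePairBound A S +
          (purePairBound A S₁ + purePairBound A S₂)) := by
  have hm : ∀ x, x ∈ S ↔ x ∈ S₁ ∨ x ∈ S₂ := fun x => by rw [hS, mem_disjUnion]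
  have hc : #S = #S₁ + #S₂ := by rw [hS, card_disjUnion]
  have ha : #(S.filter (· ∈ A)) = #(S₁.filter (· ∈ A)) + #(S₂.filter (· ∈ A)) := by
    rw [hS, disjUnion_eq_union, filter_union, card_union_of_disjoint (disjoint_filter_filter hd)]
  refine ⟨fun hSA => ?_, fun hSA => ?_⟩
  · have hf : ∀ U ⊆ S, U.filter (· ∈ A) = U ∧ U.filter (· ∉ A) = ∅ := fun U hU =>
      ⟨filter_true_of_mem fun x hx => hSA (hU hx),
        filter_false_of_mem fun x hx => not_not.2 (hSA (hU hx))⟩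
    have hS₁ := hf S₁ fun x hx => (hm x).2 (Or.inl hx)
    have hS₂ := hf S₂ fun x hx => (hm x).2 (Or.inr hx)
    have hs := splitRevenue_le_card_mul S₁ S₂
    have h3 : 0 ≤ τ * ((#S₁ : ℝ) * #S₂) := by positivity
    simp only [revenuePotential, purePairBound, hS₁, hS₂, hf S subset_rfl, hc, card_empty,
      Nat.cast_choose_two, Nat.cast_zero]
    push_cast
    nlinarith
  · obtain ⟨x, hx, hxA⟩ := not_subset.1 hSA
    have hs := splitRevenue_le_of_far hℓ hA hVA hτ
      (fun y hy => hSV ((hm y).2 (Or.inl hy))) (fun y hy => hSV ((hm y).2 (Or.inr hy)))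
      ((hm x).1 hx) hxA
    simp only [revenuePotential, hc, ha, Nat.cast_choose_two]
    push_cast
    linarith

open Classical in
theorem sum_properFlips_revenuePotential_le (hℓ : ∀ x, |ℓ x| ≤ ‖x‖) (hA : ∀ x ∈ A, ℓ x = 0)
    (hVA : ∀ x ∈ V, x ∉ A → ℓ x = 1) (hτ : ∀ i ∈ A, ∀ j ∈ A, dist i j * #V ≤ τ) (h0 : 0 ≤ τ)
    {S : Finset E} (hSV : S ⊆ V) :
    ∑ c with c ∈ properFlips S, (splitRevenue (coinSide c true) (coinSide c false) +
        revenuePotential A τ (coinSide c true) + revenuePotential A τ (coinSide c false)) ≤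
      ∑ c : S → Bool with c ∈ properFlips S, revenuePotential A τ S := by
  have key := fun c : S → Bool => splitRevenue_add_revenuePotential_le hℓ hA hVA hτ h0 hSV
    (coinSide_disjoint c) (coinSide_union c)
  by_cases hSA : S ⊆ A
  · exact sum_le_sum fun c _ => (key c).1 hSA
  · have hsum := sum_properFlips_purePairBound_le A S
    calc _ ≤ ∑ c : S → Bool with c ∈ properFlips S,
          (revenuePotential A τ S - purePairBound A S +
            (purePairBound A (coinSide c true) + purePairBound A (coinSide c false))) :=
          sum_le_sum fun c _ => (key c).2 hSA
      _ ≤ _ := by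
          rw [sum_add_distrib, sum_sub_distrib]
          linarith

end Geometry

/-! ### The point set -/

section Construction

theorem EuclideanSpace.dist_single_single_of_ne {ι : Type*} [Fintype ι] [DecidableEq ι] {i j : ι}
    (hij : i ≠ j) (a : ℝ) :
    dist (EuclideanSpace.single i a) (EuclideanSpace.single j a) = √2 * |a| := by
  have h : dist (EuclideanSpace.single i a) (EuclideanSpace.single j a) ^ 2 = (√2 * |a|) ^ 2 := by
    rw [dist_eq_norm, norm_sub_sq_real, mul_pow, Real.sq_sqrt zero_le_two]
    have h0 : inner ℝ (EuclideanSpace.single i a) (EuclideanSpace.single j a) = 0 := by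
      rw [EuclideanSpace.inner_single_left, PiLp.single_apply, if_neg hij, mul_zero]
    simp only [h0, PiLp.norm_single, Real.norm_eq_abs]
    ring
  exact (sq_eq_sq₀ dist_nonneg (by positivity)).1 h

/-- Two equidistant point sets with the same mutual distance `r`, whose first coordinates are
`0` and `1`, respectively. -/
theorem exists_equidistant_pair (a b : ℕ) {r : ℝ} (hr : 0 < r) :
    ∃ A B : Finset (EuclideanSpace ℝ (Fin (a + b + 1))), #A = a ∧ #B = b ∧
      (∀ x ∈ A, x 0 = 0) ∧ (∀ x ∈ B, x 0 = 1) ∧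
      (∀ x ∈ A, ∀ y ∈ A, x ≠ y → dist x y = r) ∧ ∀ x ∈ B, ∀ y ∈ B, x ≠ y → dist x y = r := by
  classical
  -- Basis vectors scaled by `r / √2` lie at mutual distance `r`; the successor indices keep
  -- coordinate `0` free for shifting `B`.
  set q : Fin (a + b) → EuclideanSpace ℝ (Fin (a + b + 1)) :=
    fun i => EuclideanSpace.single i.succ (r / √2) with hq
  have hdist : ∀ i j, i ≠ j → dist (q i) (q j) = r := fun i j hij => by
    rw [hq, EuclideanSpace.dist_single_single_of_ne fun h => hij (Fin.succ_injective _ h),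
      abs_of_pos (by positivity)]
    field_simp
  have hinj : Function.Injective q := fun i j h => by
    by_contra hij
    have := hdist i j hij
    rw [h, dist_self] at this
    exact hr.ne this
  have h0 : ∀ i, q i 0 = 0 := fun i => by
    simp [hq]
  refine ⟨univ.image fun i : Fin a => q (Fin.castAdd b i),
    univ.image fun i : Fin b => q (Fin.natAdd a i) + EuclideanSpace.single 0 1, ?_, ?_, ?_, ?_,
    ?_, ?_⟩
  · exact (card_image_of_injective _ (hinj.comp (Fin.castAdd_injective a b))).trans (card_fin a)
  · exact (card_image_of_injective _
      ((add_left_injective _).comp (hinj.comp (Fin.natAdd_injective b a)))).trans (card_fin b)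
  · simp [h0]
  · simp [h0]
  · intro x hx y hy hxy
    obtain ⟨i, _, rfl⟩ := mem_image.1 hx
    obtain ⟨j, _, rfl⟩ := mem_image.1 hy
    exact hdist _ _ fun h => hxy (by rw [h])
  · intro x hx y hy hxy
    obtain ⟨i, _, rfl⟩ := mem_image.1 hx
    obtain ⟨j, _, rfl⟩ := mem_image.1 hy
    rw [dist_add_right]
    exact hdist _ _ fun h => hxy (by rw [h])

end Construction

/-! ### Choice of parameters and conclusion -/

theorem mainTheorem4 :
    ∃ ε : ℝ, 0 < ε ∧ ε < 1 ∧ ∃ C : ℝ, 0 < C ∧ ∀ n : ℕ, 1 ≤ n →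
      ∃ (m : ℕ) (V : Finset (EuclideanSpace ℝ (Fin m))) (hV : V.Nonempty),
        V.card = n ^ 2 + n ∧
        expectedRevenue V hV ≤ C * (n : ℝ) ^ (-ε) * OPT V := by
  classical
  -- The argument gives the ratio `3 * n ^ 3 / (n ^ 4 / 2) = 6 / n`; any exponent in `(0, 1)` would
  -- do.
  refine ⟨1 / 2, by norm_num, by norm_num, 6, by norm_num, fun n hn => ?_⟩
  have hn1 : (1 : ℝ) ≤ n := by exact_mod_cast hn
  have hn0 : (0 : ℝ) < n := by linarith
  have hN1 : (1 : ℝ) ≤ (n : ℝ) ^ 2 + n := by nlinarith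
  -- Chosen so that `r * #V = 1 / n`, the rate `τ`.
  set r : ℝ := ((n : ℝ) * (n ^ 2 + n))⁻¹ with hr
  have hr0 : 0 < r := by positivity
  have hr1 : r ≤ 1 := inv_le_one_of_one_le₀ (by nlinarith)
  obtain ⟨A, B, hAc, hBc, hA0, hB1, hAr, hBr⟩ := exists_equidistant_pair (n ^ 2) n hr0
  have hd : Disjoint A B := Finset.disjoint_left.2 fun x hA hB => by
    have h := hA0 x hA
    rw [hB1 x hB] at h
    exact one_ne_zero h
  have hA : A.Nonempty := card_pos.1 (by rw [hAc]; positivity)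
  have hB : B.Nonempty := card_pos.1 (by rw [hBc]; exact hn)
  have hAB : ∀ x ∈ A, ∀ y ∈ B, r ≤ dist x y := fun x hx y hy => by
    have h := PiLp.norm_apply_le (y - x) 0
    rw [PiLp.sub_apply, hA0 x hx, hB1 y hy, sub_zero, norm_one, ← dist_eq_norm, dist_comm] at h
    exact hr1.trans h
  obtain ⟨V, hVdef⟩ : ∃ V, V = A.disjUnion B hd := ⟨_, rfl⟩
  have hVc : #V = n ^ 2 + n := by rw [hVdef, card_disjUnion, hAc, hBc]
  have hV : V.Nonempty := card_pos.1 (by rw [hVc]; positivity)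
  refine ⟨_, V, hV, hVc, ?_⟩
  have hopt := le_OPT_of_equidistant hd hVdef hA hB hr0.le hAr hBr hAB
  have hτ : ∀ x ∈ A, ∀ y ∈ A, dist x y * #V ≤ (n : ℝ)⁻¹ := fun x hx y hy => by
    have hxy : dist x y ≤ r := by
      by_cases h : x = y
      · rw [h, dist_self]; exact hr0.le
      · exact (hAr x hx y hy h).le
    calc dist x y * #V ≤ r * #V := by gcongr
      _ = (n : ℝ)⁻¹ := by rw [hVc, hr]; push_cast; field_simp
  have hexp : expectedRevenue V hV ≤ revenuePotential A (n : ℝ)⁻¹ V :=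
    expectedRevenue_le_of_expect_le (revenuePotential_nonneg (by positivity) A V)
      (expect_treeRevenue_le V (revenuePotential A (n : ℝ)⁻¹)
        (revenuePotential_nonneg (by positivity) A)
        (fun S hSV => by
          convert sum_properFlips_revenuePotential_le (ℓ := PiLp.projₗ 2 (fun _ => ℝ) 0)
            (fun x => PiLp.norm_apply_le x 0) hA0
            (fun x hx hxA => hB1 x (by rw [hVdef, mem_disjUnion] at hx; exact hx.resolve_left hxA))
            hτ (by positivity) hSV)
        V subset_rfl hV)
  have hVA : V.filter (· ∈ A) = A := by
    ext x; simp only [hVdef, mem_filter, mem_disjUnion]; tauto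
  have hVB : V.filter (· ∉ A) = B := by
    ext x
    simp only [hVdef, mem_filter, mem_disjUnion]
    have := fun h : x ∈ B => Finset.disjoint_right.1 hd h
    tauto
  -- The exact value is `2 * n ^ 3 - n`.
  have hpot : revenuePotential A (n : ℝ)⁻¹ V ≤ 3 * n ^ 3 := by
    simp only [revenuePotential, purePairBound, hVA, hVB, hAc, hBc, hVc, Nat.cast_choose_two]
    push_cast
    have e1 : (n : ℝ)⁻¹ * (n ^ 2 * (n ^ 2 - 1) / 2) = n * (n ^ 2 - 1) / 2 := by field_simp
    have e2 : (n : ℝ) ^ 2 * (n ^ 2 - 1) / 2 * (n + 1 : ℝ)⁻¹ = n ^ 2 * (n - 1) / 2 := by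
      field_simp; ring
    rw [e2, sub_mul, e1]
    nlinarith [sq_nonneg (n : ℝ), mul_nonneg (sq_nonneg (n : ℝ)) (sub_nonneg.2 hn1)]
  have hopt' : (n : ℝ) ^ 4 / 2 ≤ OPT V := by
    rw [hAc, hBc, Nat.cast_choose_two] at hopt
    push_cast at hopt
    nlinarith [mul_nonneg (sq_nonneg (n : ℝ)) (sub_nonneg.2 hn1)]
  have hpow : (n : ℝ)⁻¹ ≤ (n : ℝ) ^ (-(1 / 2) : ℝ) := by
    rw [← Real.rpow_neg_one]
    exact Real.rpow_le_rpow_of_exponent_le hn1 (by norm_num)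
  calc expectedRevenue V hV ≤ 3 * n ^ 3 := hexp.trans hpot
    _ = 6 * (n : ℝ)⁻¹ * (n ^ 4 / 2) := by field_simp; norm_num
    _ ≤ 6 * (n : ℝ) ^ (-(1 / 2) : ℝ) * OPT V := by gcongr
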